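/- **Theorem 1 (Pointwise LDP for the Wolverton and Wagner estimator).** Let $d\ge 1$ and let $X_1,X_2,\dots$ be independent, identically distributed $\mathbb{R}^d$-valued random vectors with a bounded probability density $f$. Let $K:\mathbb{R}^d\to\mathbb{R}$ be a bounded integrable function with $\int_{\mathbb{R}^d}K(z)\,dz=1$ and $\lim_{\|z\|\to\infty}K(z)=0$. Let $\gamma_n=1/n$ and $h_n=c\,n^{-a}$ with $c>0$ and $a\in\,]0,1/d[$, and, for $x\in\mathbb{R}^d$ and an arbitrary $f_0(x)\in\mathbb{R}$, define for $n\ge 1$ $$f_n(x)=(1-\gamma_n)f_{n-1}(x)+\gamma_n h_n^{-d}K\!\left(\frac{x-X_n}{h_n}\right).$$ For $u,t\in\mathbb{R}$ put $$\psi_a(u)=\int_{[0,1]\times\mathbb{R}^d}s^{-ad}\left(e^{u s^{ad}K(z)}-1\right)ds\,dz,\qquad I_a(t)=\sup_{u\in\mathbb{R}}\{ut-\psi_a(u)\}\in[-\infty,\infty],$$ where the integral converges absolutely for every $u$. If $f(x)\neq 0$ let $I_{a,x}(t)=f(x)\,I_a\!\left(1+\frac{t}{f(x)}\right)$; if $f(x)=0$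 let $I_{a,x}(0)=0$ and $I_{a,x}(t)=+\infty$ for $t\ne 0$. If $f$ is continuous at $x$, then the sequence $(f_n(x)-f(x))_{n\ge1}$ satisfies a large deviations principle with speed $\nu_n=nh_n^d$ and good rate function $I_{a,x}$. That is: $\nu_n>0$ and $\nu_n\to\infty$; $I_{a,x}$ takes values in $[0,\infty]$ and has compact level sets $\{t: I_{a,x}(t)\le\alpha\}$, $\alpha\in\mathbb{R}$; and for every Borel set $B\subset\mathbb{R}$, with interior $\mathring{B}$ and closure $\overline{B}$, $$-\inf_{t\in\mathring{B}}I_{a,x}(t)\le\liminf_{n\to\infty}\nu_n^{-1}\log\mathbb{P}[f_n(x)-f(x)\in B]\le\limsup_{n\to\infty}\nu_n^{-1}\log\mathbb{P}[f_n(x)-f(x)\in B]\le-\inf_{t\in\overline{B}}I_{a,x}(t).$$ -/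

import Mathlib

open MeasureTheory ProbabilityTheory Filter Topology

noncomputable section

/-- The sequence `(Z n)_{n ≥ 1}` of random elements satisfies a large deviations principle under
`P`, with speed `ν` and good rate function `I` (values in `[0, ∞]`, compact level sets).
Logarithms are `[-∞, ∞]`-valued, with `log 0 = -∞`; the infimum over the empty set is `+∞`. -/
structure SatisfiesLDP {Ω E : Type*} [MeasurableSpace Ω] [TopologicalSpace E] [MeasurableSpace E]
    [BorelSpace E] (P : Measure Ω) (Z : ℕ → Ω → E) (ν : ℕ → ℝ) (I : E → EReal) : Prop where
  speed_pos : ∀ n, 1 ≤ n → 0 < ν n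
  speed_tendsto : Tendsto ν atTop atTop
  rate_nonneg : ∀ t, 0 ≤ I t
  rate_compact : ∀ α : ℝ, IsCompact {t | I t ≤ (α : EReal)}
  lower : ∀ B : Set E, MeasurableSet B →
    -(⨅ t ∈ interior B, I t) ≤
      liminf (fun n => (((ν n)⁻¹ : ℝ) : EReal) * ENNReal.log (P {ω | Z n ω ∈ B})) atTop
  upper : ∀ B : Set E, MeasurableSet B →
    limsup (fun n => (((ν n)⁻¹ : ℝ) : EReal) * ENNReal.log (P {ω | Z n ω ∈ B})) atTop ≤
      -(⨅ t ∈ closure B, I t)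

/-- The recursive kernel density estimator at the point `x`, with kernel `K`, stepsizes `γ`,
bandwidths `h` and deterministic initial value `f₀`:
`f_n(x) = (1 - γ_n) f_{n-1}(x) + γ_n h_n^{-d} K((x - X_n) / h_n)` for `n ≥ 1`.
The observations `X_1, X_2, …` are `X 0, X 1, …`. -/
def recursiveEstimator {Ω : Type*} {d : ℕ} (K : EuclideanSpace ℝ (Fin d) → ℝ) (γ h : ℕ → ℝ)
    (X : ℕ → Ω → EuclideanSpace ℝ (Fin d)) (f₀ : ℝ) (x : EuclideanSpace ℝ (Fin d)) :
    ℕ → Ω → ℝ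
  | 0, _ => f₀
  | n + 1, ω =>
      (1 - γ (n + 1)) * recursiveEstimator K γ h X f₀ x n ω +
        γ (n + 1) * ((h (n + 1) ^ d)⁻¹ * K ((h (n + 1))⁻¹ • (x - X n ω)))

/-- The integrand `(s, z) ↦ s^{-ad} (exp (u s^{ad} K(z)) - 1)`. -/
def psiIntegrand {d : ℕ} (a : ℝ) (K : EuclideanSpace ℝ (Fin d) → ℝ) (u : ℝ)
    (p : ℝ × EuclideanSpace ℝ (Fin d)) : ℝ :=
  p.1 ^ (-(a * d)) * (Real.exp (u * p.1 ^ (a * d) * K p.2) - 1)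

/-- `ψ_a(u)`, the integral of `psiIntegrand` over `[0,1] × ℝ^d`. -/
def psi {d : ℕ} (a : ℝ) (K : EuclideanSpace ℝ (Fin d) → ℝ) (u : ℝ) : ℝ :=
  ∫ p in (Set.Icc (0 : ℝ) 1) ×ˢ (Set.univ : Set (EuclideanSpace ℝ (Fin d))), psiIntegrand a K u p

/-- The Legendre transform `t ↦ sup_u (u t - ψ(u))` of `ψ`, with values in `[-∞, ∞]`. -/
def legendre (ψ : ℝ → ℝ) (t : ℝ) : EReal :=
  ⨆ u : ℝ, ((u * t - ψ u : ℝ) : EReal)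

/-- The rate function at a point where the density takes the value `y`:
`t ↦ y I_a(1 + t / y)` if `y ≠ 0`, and the degenerate one (`0` at `0`, `+∞` elsewhere) if `y = 0`,
where `I_a` is the Legendre transform of `ψ_a`. -/
def rateFunction {d : ℕ} (a : ℝ) (K : EuclideanSpace ℝ (Fin d) → ℝ) (y t : ℝ) : EReal :=
  open Classical in
  if y ≠ 0 then (y : EReal) * legendre (psi a K) (1 + t / y)
  else if t = 0 then 0 else ⊤

end

/-!
The large deviations principle is an instance of the Gärtner–Ellis theorem on the real line.

With stepsizes `1 / n` the estimator is the average of the independent variables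
`h_k ^ (-d) * K ((x - X_k) / h_k)`, `k ≤ n`. A change of variables shows that the exponential moment
of such a variable at `u * h_n ^ d` is `1 + h_n ^ d * G`, with
`G = ∫ (exp (u * r * K z) - 1) / r * f (x - h_k * z) dz` and `r = (h_n / h_k) ^ d = (k / n) ^ (a d)`
(`mgf_kernel_eq`). Since `G` is bounded and `h_n ^ d → 0`, the logarithm may be linearised
(`tendsto_average_log_one_add`), and the cumulant generating function at the scale `n * h_n ^ d` is
asymptotically the average of the numbers `G` over `k ≤ n`, up to the centring term. This average is
a Riemann sum in `s = k / n`; by continuity of `f` at `x` and dominated convergence its limit is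
`f x * ψ_a(u)` (`tendsto_average_kernelMoment`). So the scaled cumulant generating functions of
`f_n(x) - f(x)` converge to `Λ(u) = f x * (ψ_a(u) - u)`, whose Legendre transform is the rate
function (`rateFunction_eq_legendre`).

The function `Λ` is finite and differentiable on the whole line (`differentiable_psi`) and
nonnegative, since `exp y - 1 ≥ y` and `∫ K = 1` give `ψ_a(u) ≥ u` (`le_psi`). For such a limit the
Gärtner–Ellis theorem (`satisfiesLDP_legendre`) has a short proof. The upper bound follows from
Chernoff's inequality on two half-lines. The lower bound at a slope of `Λ` is the change of measure
argument (`eventually_exp_le_measureReal_ball`); a point `t > 0` of finite rate need not be a slope,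
but all the points of `(0, t)` are (`exists_deriv_eq_of_legendre_ne_top`), and the rate is monotone
there.
-/

/-! ### The Legendre transform -/

theorem le_legendre (Λ : ℝ → ℝ) (u t : ℝ) : ((u * t - Λ u : ℝ) : EReal) ≤ legendre Λ t :=
  le_iSup (fun u : ℝ => ((u * t - Λ u : ℝ) : EReal)) u

theorem exists_lt_of_lt_legendre {Λ : ℝ → ℝ} {r t : ℝ} (h : (r : EReal) < legendre Λ t) :
    ∃ u, r < u * t - Λ u := by
  obtain ⟨u, hu⟩ := lt_iSup_iff.1 h
  exact ⟨u, EReal.coe_lt_coe_iff.1 hu⟩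

theorem legendre_nonneg {Λ : ℝ → ℝ} (h0 : Λ 0 = 0) (t : ℝ) : 0 ≤ legendre Λ t := by
  simpa [h0] using le_legendre Λ 0 t

theorem legendre_comp_neg (Λ : ℝ → ℝ) (t : ℝ) :
    legendre (fun u => Λ (-u)) (-t) = legendre Λ t := by
  unfold legendre
  rw [← (Equiv.neg ℝ).iSup_comp]
  simp

theorem isCompact_legendre_le (Λ : ℝ → ℝ) (α : ℝ) : IsCompact {t | legendre Λ t ≤ (α : EReal)} := by
  have key : {t | legendre Λ t ≤ (α : EReal)} = ⋂ u : ℝ, {t | u * t - Λ u ≤ α} := by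
    ext t
    simp only [legendre, iSup_le_iff, EReal.coe_le_coe_iff, Set.mem_ofPred_eq, Set.mem_iInter]
  rw [key]
  refine (isCompact_Icc (a := -(α + Λ (-1))) (b := α + Λ 1)).of_isClosed_subset
    (isClosed_iInter fun u => isClosed_le (by fun_prop) (by fun_prop)) fun t ht => ?_
  rw [Set.mem_iInter] at ht
  have h1 := ht 1
  have h2 := ht (-1)
  simp only [Set.mem_ofPred_eq] at h1 h2
  constructor <;> linarith

/-- Finiteness of the transform at `t > 0` makes every point of `(0, t)` a slope of `Λ`:
for `0 < s < t` the function `v ↦ v * s - Λ v` tends to `-∞` on both sides, so it has a maximiser. -/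
theorem exists_deriv_eq_of_legendre_ne_top {Λ : ℝ → ℝ} (hdiff : Differentiable ℝ Λ) (h0 : Λ 0 = 0)
    (hΛ : ∀ u, 0 ≤ Λ u) {s t : ℝ} (hs : 0 < s) (hst : s < t) (ht : legendre Λ t ≠ ⊤) :
    ∃ u, 0 ≤ u ∧ HasDerivAt Λ s u := by
  have hnb : legendre Λ t ≠ ⊥ := ne_bot_of_le_ne_bot (by simp) (legendre_nonneg h0 t)
  obtain ⟨r, hr⟩ : ∃ r : ℝ, (r : EReal) = legendre Λ t :=
    ⟨_, EReal.coe_toReal ht hnb⟩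
  have hbd : ∀ u, u * t - Λ u ≤ r := fun u => by
    have := le_legendre Λ u t
    rw [← hr] at this
    exact_mod_cast this
  have hr0 : 0 ≤ r := by simpa [h0] using hbd 0
  set U := r / (t - s) with hU
  have hts : 0 < t - s := sub_pos.2 hst
  have hU0 : 0 ≤ U := div_nonneg hr0 hts.le
  obtain ⟨u, hu, hmax⟩ := isCompact_Icc.exists_isMaxOn (Set.nonempty_Icc.2 hU0)
    (f := fun v => v * s - Λ v)
    ((continuous_id.mul continuous_const).sub hdiff.continuous).continuousOn
  have hval : 0 ≤ u * s - Λ u := by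
    simpa [h0] using hmax (Set.left_mem_Icc.2 hU0)
  have hglob : ∀ v, v * s - Λ v ≤ u * s - Λ u := by
    intro v
    rcases lt_or_ge v 0 with hv | hv
    · have := hΛ v
      nlinarith
    rcases le_or_gt v U with hvU | hvU
    · exact hmax ⟨hv, hvU⟩
    · have h1 := hbd v
      have h2 : r < v * (t - s) := by rwa [hU, div_lt_iff₀ hts] at hvU
      nlinarith
  have hd : HasDerivAt (fun v => v * s - Λ v) (1 * s - deriv Λ u) u :=
    ((hasDerivAt_id u).mul_const s).sub (hdiff u).hasDerivAt
  have hz := IsLocalMax.hasDerivAt_eq_zero (Filter.Eventually.of_forall hglob) hd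
  refine ⟨u, hu.1, ?_⟩
  have : deriv Λ u = s := by linarith
  exact this ▸ (hdiff u).hasDerivAt

/-! ### Probabilities on the exponential scale -/

section Scale

variable {Ω : Type*} [MeasurableSpace Ω] {P : Measure Ω} [IsProbabilityMeasure P] {S : Set Ω}

theorem inv_mul_log_measure_le {ν y : ℝ} (hν : 0 < ν) (h : P.real S ≤ Real.exp (ν * y)) :
    ((ν⁻¹ : ℝ) : EReal) * ENNReal.log (P S) ≤ (y : EReal) := by
  have h1 : P S ≤ ENNReal.ofReal (Real.exp (ν * y)) := by
    rw [← ofReal_measureReal]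
    exact ENNReal.ofReal_le_ofReal h
  have h2 := ENNReal.log_monotone h1
  rw [ENNReal.log_ofReal_of_pos (Real.exp_pos _), Real.log_exp] at h2
  calc ((ν⁻¹ : ℝ) : EReal) * ENNReal.log (P S)
      ≤ ((ν⁻¹ : ℝ) : EReal) * ((ν * y : ℝ) : EReal) :=
        mul_le_mul_of_nonneg_left h2 (by exact_mod_cast (inv_pos.2 hν).le)
    _ = (y : EReal) := by
        rw [← EReal.coe_mul, inv_mul_cancel_left₀ hν.ne']

theorem le_inv_mul_log_measure {ν y : ℝ} (hν : 0 < ν) (h : Real.exp (ν * y) ≤ P.real S) :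
    (y : EReal) ≤ ((ν⁻¹ : ℝ) : EReal) * ENNReal.log (P S) := by
  have h1 : ENNReal.ofReal (Real.exp (ν * y)) ≤ P S := by
    rw [← ofReal_measureReal]
    exact ENNReal.ofReal_le_ofReal h
  have h2 := ENNReal.log_monotone h1
  rw [ENNReal.log_ofReal_of_pos (Real.exp_pos _), Real.log_exp] at h2
  calc (y : EReal) = ((ν⁻¹ : ℝ) : EReal) * ((ν * y : ℝ) : EReal) := by
        rw [← EReal.coe_mul, inv_mul_cancel_left₀ hν.ne']
    _ ≤ ((ν⁻¹ : ℝ) : EReal) * ENNReal.log (P S) :=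
        mul_le_mul_of_nonneg_left h2 (by exact_mod_cast (inv_pos.2 hν).le)

end Scale

/-! ### The Gärtner–Ellis theorem on the real line -/

section GartnerEllis

variable {Ω : Type*} [MeasurableSpace Ω] {P : Measure Ω} [IsProbabilityMeasure P]
  {Z : ℕ → Ω → ℝ} {ν : ℕ → ℝ} {Λ : ℝ → ℝ}

theorem eventually_measureReal_ge_le (hint : ∀ n u, Integrable (fun ω => Real.exp (u * Z n ω)) P)
    (hν : Tendsto ν atTop atTop) {u x y : ℝ} (hu : 0 ≤ u)
    (hlim : Tendsto (fun n => cgf (Z n) P (ν n * u) / ν n) atTop (𝓝 (Λ u)))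
    (hy : Λ u - u * x < y) :
    ∀ᶠ n in atTop, P.real {ω | x ≤ Z n ω} ≤ Real.exp (ν n * y) := by
  filter_upwards [hlim.eventually_lt_const (show Λ u < y + u * x by linarith),
    hν.eventually_gt_atTop 0] with n h1 h2
  refine (measure_ge_le_exp_cgf x (mul_nonneg h2.le hu) (hint n _)).trans ?_
  rw [div_lt_iff₀ h2] at h1
  apply Real.exp_le_exp.2
  linarith

theorem eventually_measureReal_le_le (hint : ∀ n u, Integrable (fun ω => Real.exp (u * Z n ω)) P)
    (hν : Tendsto ν atTop atTop) {u x y : ℝ} (hu : u ≤ 0)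
    (hlim : Tendsto (fun n => cgf (Z n) P (ν n * u) / ν n) atTop (𝓝 (Λ u)))
    (hy : Λ u - u * x < y) :
    ∀ᶠ n in atTop, P.real {ω | Z n ω ≤ x} ≤ Real.exp (ν n * y) := by
  filter_upwards [hlim.eventually_lt_const (show Λ u < y + u * x by linarith),
    hν.eventually_gt_atTop 0] with n h1 h2
  refine (measure_le_le_exp_cgf x (mul_nonpos_of_nonneg_of_nonpos h2.le hu) (hint n _)).trans ?_
  rw [div_lt_iff₀ h2] at h1
  apply Real.exp_le_exp.2
  linarith

/-- The local lower bound. It is the change of measure argument with density proportional to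
`exp (ν n * u * Z n)`: the two tails of the tilted law are bounded by the exponential moments at
`u + η` and `u - η`, and they are negligible since `t` is the slope of `Λ` at `u`. -/
theorem eventually_exp_le_measureReal_ball
    (hint : ∀ n u, Integrable (fun ω => Real.exp (u * Z n ω)) P)
    (hZ : ∀ n, AEMeasurable (Z n) P) (hν : Tendsto ν atTop atTop)
    (hlim : ∀ u, Tendsto (fun n => cgf (Z n) P (ν n * u) / ν n) atTop (𝓝 (Λ u)))
    {u t ε δ : ℝ} (hu : HasDerivAt Λ t u) (hε : 0 < ε) (hδ : 0 < δ) :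
    ∀ᶠ n in atTop, Real.exp (ν n * (Λ u - u * t - |u| * ε - δ)) ≤
      P.real {ω | Z n ω ∈ Metric.ball t ε} := by
  obtain ⟨η, hη, hη1, hη2⟩ : ∃ η > 0, Λ (u + η) - η * (t + ε) < Λ u ∧
      Λ (u - η) + η * (t - ε) < Λ u := by
    have h := hasDerivAt_iff_tendsto_slope_zero.1 hu
    obtain ⟨r, hr, hr'⟩ := Metric.mem_nhdsWithin_iff.1 (h (Metric.ball_mem_nhds t hε))
    have hball : ∀ v : ℝ, |v| < r → v ≠ 0 → |v⁻¹ * (Λ (u + v) - Λ u) - t| < ε := fun v hv hv0 => by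
      simpa [Real.dist_eq] using hr' ⟨by simpa using hv, by simpa using hv0⟩
    have hp : |r / 2| < r := by rw [abs_of_pos (by linarith)]; linarith
    have h1 := (abs_lt.1 (hball (r / 2) hp (by positivity))).2
    have h2 := (abs_lt.1 (hball (-(r / 2)) (by rwa [abs_neg]) (by linarith))).1
    refine ⟨r / 2, by positivity, ?_, ?_⟩
    · have h3 : (r / 2)⁻¹ * (Λ (u + r / 2) - Λ u) < t + ε := by linarith
      rw [inv_mul_lt_iff₀ (by positivity)] at h3
      linarith
    · have h3 : t - ε < (r / 2)⁻¹ * (Λ u - Λ (u - r / 2)) := by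
        rw [inv_neg, ← sub_eq_add_neg] at h2
        linarith
      rw [lt_inv_mul_iff₀ (by positivity)] at h3
      linarith
  -- The tails have to be smaller than the main term by a factor `exp (-2 * ν n * κ)`.
  obtain ⟨κ, hκ, hκδ, hκ1, hκ2⟩ : ∃ κ > 0, 2 * κ ≤ δ ∧ Λ (u + η) - η * (t + ε) < Λ u - 3 * κ ∧
      Λ (u - η) + η * (t - ε) < Λ u - 3 * κ := by
    refine ⟨min δ (min (Λ u - (Λ (u + η) - η * (t + ε)))
      (Λ u - (Λ (u - η) + η * (t - ε)))) / 4, ?_, ?_, ?_, ?_⟩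
    · have : 0 < min δ (min (Λ u - (Λ (u + η) - η * (t + ε)))
        (Λ u - (Λ (u - η) + η * (t - ε)))) := lt_min hδ (lt_min (by linarith) (by linarith))
      linarith
    all_goals
      have a1 := min_le_left δ (min (Λ u - (Λ (u + η) - η * (t + ε)))
        (Λ u - (Λ (u - η) + η * (t - ε))))
      have a2 := min_le_right δ (min (Λ u - (Λ (u + η) - η * (t + ε)))
        (Λ u - (Λ (u - η) + η * (t - ε))))
      have a3 := min_le_left (Λ u - (Λ (u + η) - η * (t + ε))) (Λ u - (Λ (u - η) + η * (t - ε)))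
      have a4 := min_le_right (Λ u - (Λ (u + η) - η * (t + ε))) (Λ u - (Λ (u - η) + η * (t - ε)))
      linarith
  filter_upwards [(hlim u).eventually_const_lt (show Λ u - κ < Λ u by linarith),
    (hlim (u + η)).eventually_lt_const
      (show Λ (u + η) < Λ u - 3 * κ + η * (t + ε) by linarith),
    (hlim (u - η)).eventually_lt_const
      (show Λ (u - η) < Λ u - 3 * κ - η * (t - ε) by linarith),
    hν.eventually_gt_atTop 0, hν.eventually_ge_atTop κ⁻¹] with n h1 h2 h3 hν0 hν1
  rw [div_lt_iff₀ hν0] at h2 h3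
  rw [lt_div_iff₀ hν0] at h1
  set N := ν n with hN
  set S := {ω | Z n ω ∈ Metric.ball t ε} with hS
  have hSm : NullMeasurableSet S P := (hZ n).nullMeasurable Metric.isOpen_ball.measurableSet
  have hpt : ∀ ω, Real.exp (N * u * Z n ω) ≤
      S.indicator (fun _ => Real.exp (N * (u * t + |u| * ε))) ω +
      (Real.exp (-(N * η * (t + ε))) * Real.exp (N * (u + η) * Z n ω) +
        Real.exp (N * η * (t - ε)) * Real.exp (N * (u - η) * Z n ω)) := by
    intro ω
    rw [← Real.exp_add, ← Real.exp_add]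
    have e1 := Real.exp_pos (-(N * η * (t + ε)) + N * (u + η) * Z n ω)
    have e2 := Real.exp_pos (N * η * (t - ε) + N * (u - η) * Z n ω)
    have hNη : 0 < N * η := mul_pos hν0 hη
    by_cases hω : ω ∈ S
    · rw [Set.indicator_of_mem hω]
      have hω' : |Z n ω - t| < ε := hω
      have h5 : u * (Z n ω - t) ≤ |u| * ε :=
        (le_abs_self _).trans (by rw [abs_mul]; gcongr)
      have h4 : Real.exp (N * u * Z n ω) ≤ Real.exp (N * (u * t + |u| * ε)) := by
        apply Real.exp_le_exp.2
        rw [mul_assoc]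
        apply mul_le_mul_of_nonneg_left _ hν0.le
        linarith
      linarith
    · rw [Set.indicator_of_notMem hω]
      have hω' : ε ≤ |Z n ω - t| := not_lt.1 hω
      rcases le_abs.1 hω' with hz | hz
      · have h4 : Real.exp (N * u * Z n ω) ≤
            Real.exp (-(N * η * (t + ε)) + N * (u + η) * Z n ω) := by
          apply Real.exp_le_exp.2
          nlinarith [mul_le_mul_of_nonneg_left hz hNη.le]
        linarith
      · have h4 : Real.exp (N * u * Z n ω) ≤
            Real.exp (N * η * (t - ε) + N * (u - η) * Z n ω) := by
          apply Real.exp_le_exp.2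
          nlinarith [mul_le_mul_of_nonneg_left hz hNη.le]
        linarith
  have hI1 : Integrable (S.indicator fun _ => Real.exp (N * (u * t + |u| * ε))) P :=
    (integrable_const _).indicator₀ hSm
  have hI2 := ((hint n (N * (u + η))).const_mul (Real.exp (-(N * η * (t + ε)))))
  have hI3 := ((hint n (N * (u - η))).const_mul (Real.exp (N * η * (t - ε))))
  have hmono := integral_mono (hint n (N * u)) (hI1.add (hI2.add hI3)) hpt
  rw [integral_add' hI1 (hI2.add hI3), integral_add' hI2 hI3, integral_const_mul, integral_const_mul,
    integral_indicator₀ hSm, setIntegral_const, smul_eq_mul] at hmono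
  have hm : ∀ v, ∫ ω, Real.exp (v * Z n ω) ∂P = Real.exp (cgf (Z n) P v) :=
    fun v => (exp_cgf (hint n v)).symm
  rw [hm, hm, hm, ← Real.exp_add, ← Real.exp_add] at hmono
  set q := Real.exp (-(N * κ)) with hq
  set E := Real.exp (N * Λ u) with hE
  have hq0 : 0 < q := Real.exp_pos _
  have hq2 : q ≤ 1 / 2 := by
    have h6 : 1 ≤ N * κ := by
      have := mul_le_mul_of_nonneg_right hν1 hκ.le
      rwa [inv_mul_cancel₀ hκ.ne'] at this
    have h7 : 2 ≤ Real.exp (N * κ) := by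
      have := Real.add_one_le_exp (N * κ)
      linarith
    rw [hq, Real.exp_neg, one_div]
    exact inv_anti₀ (by norm_num) h7
  have b1 : E * q ≤ Real.exp (cgf (Z n) P (N * u)) := by
    rw [hE, hq, ← Real.exp_add]
    apply Real.exp_le_exp.2
    linarith
  have hq3 : E * q ^ 3 = Real.exp (N * Λ u - 3 * (N * κ)) := by
    rw [hE, hq, ← Real.exp_nat_mul, ← Real.exp_add]
    congr 1
    push_cast
    ring
  have b2 : Real.exp (-(N * η * (t + ε)) + cgf (Z n) P (N * (u + η))) ≤ E * q ^ 3 := by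
    rw [hq3]
    apply Real.exp_le_exp.2
    linarith
  have b3 : Real.exp (N * η * (t - ε) + cgf (Z n) P (N * (u - η))) ≤ E * q ^ 3 := by
    rw [hq3]
    apply Real.exp_le_exp.2
    linarith
  have hE0 : 0 < E := Real.exp_pos _
  have b4 : E * q ^ 2 ≤ E * q - 2 * (E * q ^ 3) := by
    have : 0 ≤ E * q * ((1 - 2 * q) * (1 + q)) :=
      mul_nonneg (by positivity) (mul_nonneg (by linarith) (by linarith))
    linarith
  have b5 : E * q ^ 2 ≤ P.real S * Real.exp (N * (u * t + |u| * ε)) := by linarith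
  have b6 : Real.exp (N * (Λ u - u * t - |u| * ε - δ)) * Real.exp (N * (u * t + |u| * ε)) ≤
      E * q ^ 2 := by
    rw [hE, hq, ← Real.exp_nat_mul, ← Real.exp_add, ← Real.exp_add]
    apply Real.exp_le_exp.2
    have := mul_le_mul_of_nonneg_left hκδ hν0.le
    push_cast
    linarith
  exact le_of_mul_le_mul_right (b6.trans b5) (Real.exp_pos _)

/-- Lower bound of the large deviations principle near a point `t ≥ 0`. If `t` itself is not a
slope of `Λ`, slightly smaller points are, and the rate there is not larger. -/
theorem neg_legendre_le_liminf_of_nonneg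
    (hint : ∀ n u, Integrable (fun ω => Real.exp (u * Z n ω)) P)
    (hZ : ∀ n, AEMeasurable (Z n) P) (hν : Tendsto ν atTop atTop)
    (hlim : ∀ u, Tendsto (fun n => cgf (Z n) P (ν n * u) / ν n) atTop (𝓝 (Λ u)))
    (hdiff : Differentiable ℝ Λ) (h0 : Λ 0 = 0) (hΛ : ∀ u, 0 ≤ Λ u)
    {B : Set ℝ} {t : ℝ} (ht : 0 ≤ t) (htB : t ∈ interior B) :
    -legendre Λ t ≤
      liminf (fun n => (((ν n)⁻¹ : ℝ) : EReal) * ENNReal.log (P {ω | Z n ω ∈ B})) atTop := by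
  rcases eq_or_ne (legendre Λ t) ⊤ with htop | htop
  · simp [htop]
  obtain ⟨r, hr, hrB⟩ := Metric.mem_nhds_iff.1 (mem_interior_iff_mem_nhds.1 htB)
  obtain ⟨s, u, hu0, hu, hst, hs⟩ : ∃ s u, 0 ≤ u ∧ HasDerivAt Λ s u ∧ s ≤ t ∧ t - r / 2 ≤ s := by
    rcases ht.eq_or_lt with rfl | htpos
    · have hmin : IsLocalMin Λ 0 := Filter.Eventually.of_forall fun u => h0.symm ▸ hΛ u
      have hd := (hdiff 0).hasDerivAt
      rw [hmin.deriv_eq_zero] at hd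
      exact ⟨0, 0, le_rfl, hd, le_rfl, by linarith⟩
    · have h1 : 0 < max (t / 2) (t - r / 2) := lt_max_of_lt_left (by linarith)
      have h2 : max (t / 2) (t - r / 2) < t := max_lt (by linarith) (by linarith)
      obtain ⟨u, hu0, hu⟩ := exists_deriv_eq_of_legendre_ne_top hdiff h0 hΛ h1 h2 htop
      exact ⟨_, u, hu0, hu, h2.le, le_max_right _ _⟩
  have hle : ∀ y : ℝ, y < -(u * s - Λ u) → (y : EReal) ≤
      liminf (fun n => (((ν n)⁻¹ : ℝ) : EReal) * ENNReal.log (P {ω | Z n ω ∈ B})) atTop := by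
    intro y hy
    set δ := -(u * s - Λ u) - y with hδ
    have hδ0 : 0 < δ := by linarith
    set ε := min (r / 2) (δ / (2 * (u + 1))) with hε
    have hε0 : 0 < ε := lt_min (by linarith) (by positivity)
    have huε : |u| * ε ≤ δ / 2 := by
      rw [abs_of_nonneg hu0]
      calc u * ε ≤ (u + 1) * (δ / (2 * (u + 1))) :=
            mul_le_mul (by linarith) (min_le_right _ _) hε0.le (by linarith)
        _ = δ / 2 := by field_simp
    refine le_liminf_of_le (by isBoundedDefault) ?_
    filter_upwards [eventually_exp_le_measureReal_ball hint hZ hν hlim hu hε0 (half_pos hδ0),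
      hν.eventually_gt_atTop 0] with n h1 h2
    apply le_inv_mul_log_measure h2
    calc Real.exp (ν n * y) ≤ Real.exp (ν n * (Λ u - u * s - |u| * ε - δ / 2)) := by
          apply Real.exp_le_exp.2
          apply mul_le_mul_of_nonneg_left _ h2.le
          linarith
      _ ≤ P.real {ω | Z n ω ∈ Metric.ball s ε} := h1
      _ ≤ P.real {ω | Z n ω ∈ B} := by
          refine measureReal_mono fun ω hω => hrB ?_
          have h3 : |Z n ω - s| < ε := hω
          have h4 : ε ≤ r / 2 := min_le_left _ _
          rw [Metric.mem_ball, Real.dist_eq, abs_lt]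
          rw [abs_lt] at h3
          constructor <;> linarith
  have hval : -legendre Λ t ≤ ((-(u * s - Λ u) : ℝ) : EReal) := by
    rw [EReal.neg_le, ← EReal.coe_neg, neg_neg]
    refine le_trans ?_ (le_legendre Λ u t)
    exact_mod_cast sub_le_sub_right (mul_le_mul_of_nonneg_left hst hu0) _
  refine hval.trans (EReal.ge_of_forall_gt_iff_ge.1 fun y hy => ?_)
  exact hle y (by exact_mod_cast hy)

theorem neg_legendre_le_liminf
    (hint : ∀ n u, Integrable (fun ω => Real.exp (u * Z n ω)) P)
    (hZ : ∀ n, AEMeasurable (Z n) P) (hν : Tendsto ν atTop atTop)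
    (hlim : ∀ u, Tendsto (fun n => cgf (Z n) P (ν n * u) / ν n) atTop (𝓝 (Λ u)))
    (hdiff : Differentiable ℝ Λ) (h0 : Λ 0 = 0) (hΛ : ∀ u, 0 ≤ Λ u)
    {B : Set ℝ} {t : ℝ} (htB : t ∈ interior B) :
    -legendre Λ t ≤
      liminf (fun n => (((ν n)⁻¹ : ℝ) : EReal) * ENNReal.log (P {ω | Z n ω ∈ B})) atTop := by
  rcases le_total 0 t with ht | ht
  · exact neg_legendre_le_liminf_of_nonneg hint hZ hν hlim hdiff h0 hΛ ht htB
  · have hB : -t ∈ interior (-B) := by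
      have := (Homeomorph.neg ℝ).preimage_interior B
      simp only [Homeomorph.coe_neg, Set.neg_preimage] at this
      rw [← this]
      simpa using htB
    have := neg_legendre_le_liminf_of_nonneg (P := P) (Z := fun n => -Z n) (ν := ν)
      (Λ := fun u => Λ (-u))
      (fun n u => by simpa using hint n (-u)) (fun n => (hZ n).neg) hν
      (fun u => by simpa [cgf_neg] using hlim (-u))
      (hdiff.comp differentiable_neg) (by simpa using h0) (fun u => hΛ _)
      (neg_nonneg.2 ht) hB
    rw [legendre_comp_neg] at this
    simpa using this

/-- The upper bound. Away from the zero `0` of the rate function a closed set is covered by two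
half-lines, and Chernoff's inequality applies to each. -/
theorem eventually_measureReal_le_exp
    (hint : ∀ n u, Integrable (fun ω => Real.exp (u * Z n ω)) P)
    (hν : Tendsto ν atTop atTop)
    (hlim : ∀ u, Tendsto (fun n => cgf (Z n) P (ν n * u) / ν n) atTop (𝓝 (Λ u)))
    (hΛ : ∀ u, 0 ≤ Λ u) {B : Set ℝ} {r : ℝ}
    (hr : ∀ t ∈ closure B, (r : EReal) < legendre Λ t) :
    ∀ᶠ n in atTop, P.real {ω | Z n ω ∈ B} ≤ Real.exp (ν n * -r) := by
  rcases lt_or_ge r 0 with hr0 | hr0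
  · filter_upwards [hν.eventually_gt_atTop 0] with n hn
    refine measureReal_le_one.trans (Real.one_le_exp ?_)
    nlinarith
  have hright : ∃ y < -r, ∀ᶠ n in atTop,
      P.real {ω | Z n ω ∈ B ∩ Set.Ici 0} ≤ Real.exp (ν n * y) := by
    rcases (closure B ∩ Set.Ici 0).eq_empty_or_nonempty with he | hne
    · refine ⟨-r - 1, by linarith, Filter.Eventually.of_forall fun n => ?_⟩
      have : B ∩ Set.Ici 0 = ∅ :=
        Set.subset_eq_empty (Set.inter_subset_inter_left _ subset_closure) he
      simp [this, Real.exp_nonneg]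
    · have hbb : BddBelow (closure B ∩ Set.Ici 0) := ⟨0, fun x hx => hx.2⟩
      have hmem := (isClosed_closure.inter isClosed_Ici).csInf_mem hne hbb
      set b := sInf (closure B ∩ Set.Ici 0)
      obtain ⟨u, hu⟩ := exists_lt_of_lt_legendre (hr b hmem.1)
      have hb : 0 ≤ b := hmem.2
      have hu0 : 0 ≤ u := by
        by_contra hneg
        have := hΛ u
        nlinarith
      obtain ⟨y, hy1, hy2⟩ := exists_between (show Λ u - u * b < -r by linarith)
      refine ⟨y, hy2, ?_⟩
      filter_upwards [eventually_measureReal_ge_le hint hν hu0 (hlim u) hy1] with n hn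
      exact (measureReal_mono fun ω hω =>
        csInf_le hbb ⟨subset_closure hω.1, hω.2⟩).trans hn
  have hleft : ∃ y < -r, ∀ᶠ n in atTop,
      P.real {ω | Z n ω ∈ B ∩ Set.Iic 0} ≤ Real.exp (ν n * y) := by
    rcases (closure B ∩ Set.Iic 0).eq_empty_or_nonempty with he | hne
    · refine ⟨-r - 1, by linarith, Filter.Eventually.of_forall fun n => ?_⟩
      have : B ∩ Set.Iic 0 = ∅ :=
        Set.subset_eq_empty (Set.inter_subset_inter_left _ subset_closure) he
      simp [this, Real.exp_nonneg]
    · have hbb : BddAbove (closure B ∩ Set.Iic 0) := ⟨0, fun x hx => hx.2⟩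
      have hmem := (isClosed_closure.inter isClosed_Iic).csSup_mem hne hbb
      set b := sSup (closure B ∩ Set.Iic 0)
      obtain ⟨u, hu⟩ := exists_lt_of_lt_legendre (hr b hmem.1)
      have hb : b ≤ 0 := hmem.2
      have hu0 : u ≤ 0 := by
        by_contra hneg
        have := hΛ u
        nlinarith
      obtain ⟨y, hy1, hy2⟩ := exists_between (show Λ u - u * b < -r by linarith)
      refine ⟨y, hy2, ?_⟩
      filter_upwards [eventually_measureReal_le_le hint hν hu0 (hlim u) hy1] with n hn
      exact (measureReal_mono fun ω hω =>
        le_csSup hbb ⟨subset_closure hω.1, hω.2⟩).trans hn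
  obtain ⟨y₁, hy₁, h₁⟩ := hright
  obtain ⟨y₂, hy₂, h₂⟩ := hleft
  set y := max y₁ y₂ with hy
  have hyr : y < -r := max_lt hy₁ hy₂
  -- The factor `2` coming from the two half-lines is absorbed by the slack `-r - y`.
  filter_upwards [h₁, h₂, hν.eventually_gt_atTop 0,
    hν.eventually_ge_atTop ((-r - y)⁻¹)] with n hn₁ hn₂ hn hn'
  have hcover : {ω | Z n ω ∈ B} ⊆ {ω | Z n ω ∈ B ∩ Set.Ici 0} ∪ {ω | Z n ω ∈ B ∩ Set.Iic 0} := by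
    intro ω hω
    rcases le_total 0 (Z n ω) with hz | hz
    · exact Or.inl ⟨hω, hz⟩
    · exact Or.inr ⟨hω, hz⟩
  have e1 : Real.exp (ν n * y₁) ≤ Real.exp (ν n * y) :=
    Real.exp_le_exp.2 (mul_le_mul_of_nonneg_left (le_max_left _ _) hn.le)
  have e2 : Real.exp (ν n * y₂) ≤ Real.exp (ν n * y) :=
    Real.exp_le_exp.2 (mul_le_mul_of_nonneg_left (le_max_right _ _) hn.le)
  have e3 : 2 * Real.exp (ν n * y) ≤ Real.exp (ν n * -r) := by
    have h6 : 1 ≤ ν n * (-r - y) := by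
      have := mul_le_mul_of_nonneg_right hn' (show 0 ≤ -r - y by linarith)
      rwa [inv_mul_cancel₀ (show -r - y ≠ 0 by linarith)] at this
    have h7 : 2 ≤ Real.exp (ν n * (-r - y)) := by
      have := Real.add_one_le_exp (ν n * (-r - y))
      linarith
    calc 2 * Real.exp (ν n * y) ≤ Real.exp (ν n * (-r - y)) * Real.exp (ν n * y) := by gcongr
      _ = Real.exp (ν n * -r) := by rw [← Real.exp_add]; ring_nf
  have e4 := (measureReal_mono (μ := P) hcover).trans (measureReal_union_le _ _)
  linarith

/-- The **Gärtner–Ellis theorem** on the real line, for a limit `Λ` of the scaled cumulant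
generating functions that is differentiable everywhere. The condition `0 ≤ Λ` says that the
variables are centred on the exponential scale: it makes `0` the zero of the rate function. -/
theorem satisfiesLDP_legendre
    (hint : ∀ n u, Integrable (fun ω => Real.exp (u * Z n ω)) P)
    (hZ : ∀ n, AEMeasurable (Z n) P) (hpos : ∀ n, 1 ≤ n → 0 < ν n) (hν : Tendsto ν atTop atTop)
    (hlim : ∀ u, Tendsto (fun n => cgf (Z n) P (ν n * u) / ν n) atTop (𝓝 (Λ u)))
    (hdiff : Differentiable ℝ Λ) (hΛ : ∀ u, 0 ≤ Λ u) :
    SatisfiesLDP P Z ν (legendre Λ) := by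
  have h0 : Λ 0 = 0 := tendsto_nhds_unique (hlim 0) (by simp)
  refine ⟨hpos, hν, legendre_nonneg h0, isCompact_legendre_le Λ, fun B _ => ?_, fun B _ => ?_⟩
  · rw [EReal.neg_le]
    refine le_iInf₂ fun t ht => ?_
    rw [EReal.neg_le]
    exact neg_legendre_le_liminf hint hZ hν hlim hdiff h0 hΛ ht
  · rw [EReal.le_neg]
    refine EReal.ge_of_forall_gt_iff_ge.1 fun r hr => ?_
    rw [EReal.le_neg, ← EReal.coe_neg]
    refine limsup_le_of_le (by isBoundedDefault) ?_
    filter_upwards [eventually_measureReal_le_exp hint hν hlim hΛ (B := B) (r := r)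
      (fun t ht => hr.trans_le (iInf₂_le t ht)), hν.eventually_gt_atTop 0] with n h1 h2
    exact inv_mul_log_measure_le h2 h1

end GartnerEllis

/-! ### The function `ψ_a` and the rate function -/

theorem Real.abs_exp_sub_one_le_mul_exp_abs (y : ℝ) :
    |Real.exp y - 1| ≤ |y| * Real.exp |y| := by
  rcases le_total 0 y with hy | hy
  · rw [abs_of_nonneg hy, abs_of_nonneg (by linarith [Real.add_one_le_exp y])]
    have h1 := mul_le_mul_of_nonneg_right (Real.add_one_le_exp (-y)) (Real.exp_pos y).le
    rw [← Real.exp_add, neg_add_cancel, Real.exp_zero] at h1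
    linarith
  · rw [abs_of_nonpos hy, abs_of_nonpos (by linarith [Real.exp_le_one_iff.2 hy])]
    have h1 := Real.add_one_le_exp y
    have h2 := mul_le_mul_of_nonneg_left (Real.one_le_exp (neg_nonneg.2 hy)) (neg_nonneg.2 hy)
    linarith

/-- The difference quotient `(exp (r * v) - 1) / r`, with the value `0` at `r = 0`. The integrand
of `ψ_a` is `expQuot (s ^ (a * d)) (u * K z)`. -/
noncomputable def expQuot (r v : ℝ) : ℝ := r⁻¹ * (Real.exp (r * v) - 1)

theorem mul_expQuot {r : ℝ} (hr : r ≠ 0) (v : ℝ) : r * expQuot r v = Real.exp (r * v) - 1 :=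
  mul_inv_cancel_left₀ hr _

theorem abs_expQuot_le {r : ℝ} (hr0 : 0 ≤ r) (hr1 : r ≤ 1) (v : ℝ) :
    |expQuot r v| ≤ |v| * Real.exp |v| := by
  rcases hr0.eq_or_lt with rfl | hr
  · simpa [expQuot] using by positivity
  rw [expQuot, abs_mul, abs_of_pos (inv_pos.2 hr), inv_mul_le_iff₀ hr]
  refine (Real.abs_exp_sub_one_le_mul_exp_abs _).trans ?_
  rw [abs_mul, abs_of_pos hr, mul_assoc]
  gcongr
  exact mul_le_of_le_one_left (abs_nonneg v) hr1

theorem le_expQuot {r : ℝ} (hr : 0 < r) (v : ℝ) : v ≤ expQuot r v := by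
  rw [expQuot, le_inv_mul_iff₀ hr]
  linarith [Real.add_one_le_exp (r * v)]

theorem continuousAt_expQuot {r : ℝ} (hr : r ≠ 0) (v : ℝ) :
    ContinuousAt (fun r => expQuot r v) r := by
  unfold expQuot
  exact (continuousAt_inv₀ hr).mul (by fun_prop)

theorem abs_expQuot_mul_le {r u k M : ℝ} (hr0 : 0 ≤ r) (hr1 : r ≤ 1) (hk : |k| ≤ M) :
    |expQuot r (u * k)| ≤ |u| * Real.exp (|u| * M) * |k| := by
  refine (abs_expQuot_le hr0 hr1 _).trans ?_
  rw [abs_mul, mul_right_comm]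
  gcongr

section Psi

variable {d : ℕ} {K : EuclideanSpace ℝ (Fin d) → ℝ} {a : ℝ}

theorem psiIntegrand_eq_expQuot {u : ℝ} {p : ℝ × EuclideanSpace ℝ (Fin d)} (hp : 0 ≤ p.1) :
    psiIntegrand a K u p = expQuot (p.1 ^ (a * d)) (u * K p.2) := by
  rw [psiIntegrand, expQuot, Real.rpow_neg hp]
  ring_nf

theorem volume_restrict_unit_prod (d : ℕ) :
    (volume : Measure (ℝ × EuclideanSpace ℝ (Fin d))).restrict
      (Set.Icc (0 : ℝ) 1 ×ˢ Set.univ) = (volume.restrict (Set.Icc (0 : ℝ) 1)).prod volume := by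
  rw [Measure.volume_eq_prod, ← Measure.prod_restrict, Measure.restrict_univ]

theorem ae_fst_mem_Ioc (d : ℕ) :
    ∀ᵐ p : ℝ × EuclideanSpace ℝ (Fin d)
      ∂((volume.restrict (Set.Icc (0 : ℝ) 1)).prod volume), p.1 ∈ Set.Ioc (0 : ℝ) 1 := by
  rw [← restrict_Ioc_eq_restrict_Icc]
  exact Measure.quasiMeasurePreserving_fst.ae (ae_restrict_mem measurableSet_Ioc)

theorem aestronglyMeasurable_psiIntegrand (hK : AEStronglyMeasurable K) (u : ℝ) :
    AEStronglyMeasurable (psiIntegrand a K u)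
      ((volume.restrict (Set.Icc (0 : ℝ) 1)).prod volume) := by
  have h1 : AEMeasurable (fun p : ℝ × EuclideanSpace ℝ (Fin d) => K p.2)
    ((volume.restrict (Set.Icc (0 : ℝ) 1)).prod volume) := hK.aemeasurable.comp_snd
  unfold psiIntegrand
  apply AEMeasurable.aestronglyMeasurable
  fun_prop

theorem integrable_psiIntegrand (ha : 0 < a) (hK : Integrable K) {M : ℝ} (hM : ∀ z, |K z| ≤ M)
    (u : ℝ) : Integrable (psiIntegrand a K u)
      ((volume.restrict (Set.Icc (0 : ℝ) 1)).prod volume) := by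
  refine ((hK.abs.comp_snd (volume.restrict (Set.Icc (0 : ℝ) 1))).const_mul
    (|u| * Real.exp (|u| * M))).mono' (aestronglyMeasurable_psiIntegrand hK.1 u) ?_
  filter_upwards [ae_fst_mem_Ioc d] with p hp
  rw [psiIntegrand_eq_expQuot hp.1.le, Real.norm_eq_abs]
  exact abs_expQuot_mul_le (Real.rpow_nonneg hp.1.le _)
    (Real.rpow_le_one hp.1.le hp.2 (by positivity)) (hM _)

theorem psi_eq_integral_prod (a : ℝ) (K : EuclideanSpace ℝ (Fin d) → ℝ) (u : ℝ) :
    psi a K u = ∫ p, psiIntegrand a K u p ∂((volume.restrict (Set.Icc (0 : ℝ) 1)).prod volume) := by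
  rw [psi, volume_restrict_unit_prod]

theorem psi_eq_intervalIntegral (ha : 0 < a) (hK : Integrable K) {M : ℝ} (hM : ∀ z, |K z| ≤ M)
    (u : ℝ) : psi a K u = ∫ s in (0 : ℝ)..1, ∫ z, expQuot (s ^ (a * d)) (u * K z) := by
  rw [psi_eq_integral_prod, integral_prod _ (integrable_psiIntegrand ha hK hM u),
    integral_Icc_eq_integral_Ioc, intervalIntegral.integral_of_le zero_le_one]
  refine setIntegral_congr_fun measurableSet_Ioc fun s hs => integral_congr_ae ?_
  exact Filter.Eventually.of_forall fun z => psiIntegrand_eq_expQuot hs.1.le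

theorem differentiable_psi (ha : 0 < a) (hK : Integrable K) {M : ℝ} (hM : ∀ z, |K z| ≤ M) :
    Differentiable ℝ (psi a K) := by
  intro u
  have hfun : psi a K = fun u => ∫ p, psiIntegrand a K u p
      ∂((volume.restrict (Set.Icc (0 : ℝ) 1)).prod volume) := funext (psi_eq_integral_prod a K)
  rw [hfun]
  have hM0 : 0 ≤ M := (abs_nonneg _).trans (hM 0)
  refine (hasDerivAt_integral_of_dominated_loc_of_deriv_le (Metric.ball_mem_nhds u one_pos)
    (F' := fun v p => p.1 ^ (-(a * d)) *
      (Real.exp (v * p.1 ^ (a * d) * K p.2) * (1 * p.1 ^ (a * d) * K p.2)))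
    (bound := fun p => Real.exp ((|u| + 1) * M) * |K p.2|)
    (Filter.Eventually.of_forall fun v => aestronglyMeasurable_psiIntegrand hK.1 v)
    (integrable_psiIntegrand ha hK hM u) ?_ ?_
    ((hK.abs.comp_snd _).const_mul _) ?_).2.differentiableAt
  · have h1 : AEMeasurable (fun p : ℝ × EuclideanSpace ℝ (Fin d) => K p.2)
      ((volume.restrict (Set.Icc (0 : ℝ) 1)).prod volume) := hK.1.aemeasurable.comp_snd
    apply AEMeasurable.aestronglyMeasurable
    fun_prop
  · filter_upwards [ae_fst_mem_Ioc d] with p hp v hv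
    have hv' : |v| ≤ |u| + 1 := by
      rw [Metric.mem_ball, Real.dist_eq] at hv
      have := abs_sub_abs_le_abs_sub v u
      linarith
    have hs0 : 0 < p.1 ^ (a * d) := Real.rpow_pos_of_pos hp.1 _
    have hs1 : p.1 ^ (a * d) ≤ 1 := Real.rpow_le_one hp.1.le hp.2 (by positivity)
    have heq : p.1 ^ (-(a * d)) *
        (Real.exp (v * p.1 ^ (a * d) * K p.2) * (1 * p.1 ^ (a * d) * K p.2)) =
        Real.exp (v * p.1 ^ (a * d) * K p.2) * K p.2 := by
      rw [Real.rpow_neg hp.1.le]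
      field_simp
    rw [heq, norm_mul, Real.norm_eq_abs, Real.norm_eq_abs, Real.abs_exp]
    refine mul_le_mul_of_nonneg_right (Real.exp_le_exp.2 ?_) (abs_nonneg _)
    calc v * p.1 ^ (a * d) * K p.2 ≤ |v * p.1 ^ (a * d) * K p.2| := le_abs_self _
      _ = |v| * p.1 ^ (a * d) * |K p.2| := by rw [abs_mul, abs_mul, abs_of_pos hs0]
      _ ≤ (|u| + 1) * 1 * M := by
          gcongr
          exact hM _
      _ = (|u| + 1) * M := by ring
  · refine Filter.Eventually.of_forall fun p v _ => ?_
    have h1 : HasDerivAt (fun v => v * p.1 ^ (a * d) * K p.2) (1 * p.1 ^ (a * d) * K p.2) v :=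
      ((hasDerivAt_id v).mul_const _).mul_const _
    exact (h1.exp.sub_const 1).const_mul _

theorem le_psi (ha : 0 < a) (hK : Integrable K) {M : ℝ} (hM : ∀ z, |K z| ≤ M)
    (hK_one : ∫ z, K z = 1) (u : ℝ) : u ≤ psi a K u := by
  have h1 : ∫ p : ℝ × EuclideanSpace ℝ (Fin d), u * K p.2
      ∂((volume.restrict (Set.Icc (0 : ℝ) 1)).prod volume) = u := by
    rw [integral_const_mul, integral_fun_snd, hK_one]
    simp
  rw [psi_eq_integral_prod]
  conv_lhs => rw [← h1]
  refine integral_mono_ae ((hK.comp_snd _).const_mul u) (integrable_psiIntegrand ha hK hM u) ?_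
  filter_upwards [ae_fst_mem_Ioc d] with p hp
  rw [psiIntegrand_eq_expQuot hp.1.le]
  exact le_expQuot (Real.rpow_pos_of_pos hp.1 _) _

/-- The rate function is the Legendre transform of the limit `u ↦ y * (ψ_a(u) - u)` of the scaled
cumulant generating functions, also in the degenerate case `y = 0`. -/
theorem rateFunction_eq_legendre (a : ℝ) (K : EuclideanSpace ℝ (Fin d) → ℝ) {y : ℝ} (hy : 0 ≤ y) :
    rateFunction a K y = legendre (fun u => y * (psi a K u - u)) := by
  funext t
  rcases hy.eq_or_lt with rfl | hy
  · simp only [rateFunction, ne_eq, not_true_eq_false, if_false, legendre, zero_mul, sub_zero]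
    split_ifs with ht
    · simp [ht]
    · refine (EReal.eq_top_iff_forall_lt _).2 (fun r => ?_) |>.symm
      refine lt_of_lt_of_le ?_ (le_iSup (fun u : ℝ => ((u * t : ℝ) : EReal)) ((r + 1) / t))
      rw [div_mul_cancel₀ _ ht]
      exact_mod_cast lt_add_one r
  · rw [rateFunction, if_pos hy.ne']
    have hval : ∀ u : ℝ, ((u * t - y * (psi a K u - u) : ℝ) : EReal) =
        (y : EReal) * ((u * (1 + t / y) - psi a K u : ℝ) : EReal) := fun u => by
      rw [← EReal.coe_mul]
      congr 1
      field_simp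
      ring
    apply le_antisymm
    · have h1 : legendre (psi a K) (1 + t / y) ≤
          ((y⁻¹ : ℝ) : EReal) * legendre (fun u => y * (psi a K u - u)) t := by
        refine iSup_le fun u => ?_
        calc ((u * (1 + t / y) - psi a K u : ℝ) : EReal)
            = ((y⁻¹ : ℝ) : EReal) * ((u * t - y * (psi a K u - u) : ℝ) : EReal) := by
              rw [hval, ← EReal.coe_mul, ← EReal.coe_mul, inv_mul_cancel_left₀ hy.ne']
          _ ≤ _ := mul_le_mul_of_nonneg_left
              (le_legendre (fun u => y * (psi a K u - u)) u t)
              (by exact_mod_cast (inv_pos.2 hy).le)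
      refine (mul_le_mul_of_nonneg_left h1 (by exact_mod_cast hy.le)).trans_eq ?_
      rw [← mul_assoc, ← EReal.coe_mul, mul_inv_cancel₀ hy.ne', EReal.coe_one, one_mul]
    · refine iSup_le fun u => ?_
      rw [hval]
      exact mul_le_mul_of_nonneg_left (le_legendre _ _ _) (by exact_mod_cast hy.le)

end Psi

/-! ### Averages and Riemann sums -/

theorem average_eq_integral_ceil (g : ℕ → ℝ) {n : ℕ} (hn : 0 < n) :
    (n : ℝ)⁻¹ * ∑ k ∈ Finset.range n, g (k + 1) = ∫ s in (0 : ℝ)..1, g ⌈(s * n : ℝ)⌉₊ := by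
  have hn' : (0 : ℝ) < n := by exact_mod_cast hn
  have hle : ∀ k : ℕ, (k : ℝ) / n ≤ ((k + 1 : ℕ) : ℝ) / n := fun k => by
    gcongr
    exact Nat.le_succ k
  have hceil : ∀ k : ℕ, ∀ s ∈ Set.Ioc ((k : ℝ) / n) (((k + 1 : ℕ) : ℝ) / n),
      g ⌈(s * n : ℝ)⌉₊ = g (k + 1) := fun k s hs => by
    congr 1
    rw [Nat.ceil_eq_iff (Nat.succ_ne_zero k)]
    rw [Set.mem_Ioc, div_lt_iff₀ hn', le_div_iff₀ hn'] at hs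
    simpa using hs
  have hcongr : ∀ k : ℕ, ∀ᵐ s : ℝ, s ∈ Set.uIoc ((k : ℝ) / n) (((k + 1 : ℕ) : ℝ) / n) →
      g (k + 1) = g ⌈(s * n : ℝ)⌉₊ := fun k =>
    Filter.Eventually.of_forall fun s hs => by
      rw [Set.uIoc_of_le (hle k)] at hs
      exact (hceil k s hs).symm
  have hsum := intervalIntegral.sum_integral_adjacent_intervals (μ := volume)
    (f := fun s : ℝ => g ⌈(s * n : ℝ)⌉₊) (a := fun k : ℕ => (k : ℝ) / n) (n := n)
    (fun k _ => (intervalIntegrable_const (c := g (k + 1))).congr_ae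
      ((ae_restrict_iff' measurableSet_uIoc).2 (hcongr k)))
  simp only [Nat.cast_zero, zero_div, div_self hn'.ne'] at hsum
  rw [← hsum, Finset.mul_sum]
  refine Finset.sum_congr rfl fun k _ => ?_
  rw [← intervalIntegral.integral_congr_ae (hcongr k), intervalIntegral.integral_const, smul_eq_mul]
  push_cast
  field_simp
  ring

theorem abs_log_one_add_sub_le {y : ℝ} (hy : |y| ≤ 1 / 2) : |Real.log (1 + y) - y| ≤ 2 * y ^ 2 := by
  have h1 := abs_le.1 hy
  have hpos : 0 < 1 + y := by linarith
  have h2 := Real.log_le_sub_one_of_pos hpos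
  have h3 := Real.one_sub_inv_le_log_of_pos hpos
  have h4 : y - (1 - (1 + y)⁻¹) ≤ 2 * y ^ 2 := by
    have : y - (1 - (1 + y)⁻¹) = y ^ 2 / (1 + y) := by
      field_simp
      ring
    rw [this, div_le_iff₀ hpos]
    nlinarith [sq_nonneg y]
  rw [abs_le]
  constructor <;> nlinarith [sq_nonneg y]

/-- In averages of `log (1 + ε n * G n k) / ε n` with `ε n → 0` and bounded `G`, the logarithm may
be linearised. -/
theorem tendsto_average_log_one_add {ε : ℕ → ℝ} (hε : Tendsto ε atTop (𝓝 0))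
    (hpos : ∀ᶠ n in atTop, 0 < ε n) {G : ℕ → ℕ → ℝ} {C L : ℝ}
    (hG : ∀ n, ∀ k < n, |G n k| ≤ C)
    (hlim : Tendsto (fun n : ℕ => (n : ℝ)⁻¹ * ∑ k ∈ Finset.range n, G n k) atTop (𝓝 L)) :
    Tendsto (fun n : ℕ => (∑ k ∈ Finset.range n, Real.log (1 + ε n * G n k)) / (n * ε n))
      atTop (𝓝 L) := by
  have hdiff : Tendsto (fun n : ℕ => (∑ k ∈ Finset.range n, Real.log (1 + ε n * G n k)) / (n * ε n) -
      (n : ℝ)⁻¹ * ∑ k ∈ Finset.range n, G n k) atTop (𝓝 0) := by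
    have hb : Tendsto (fun n => 2 * C ^ 2 * ε n) atTop (𝓝 0) := by
      simpa using hε.const_mul (2 * C ^ 2)
    have hsmall : Tendsto (fun n => ε n * C) atTop (𝓝 0) := by simpa using hε.mul_const C
    refine squeeze_zero_norm' ?_ hb
    filter_upwards [hpos, hsmall.eventually_lt_const (show (0 : ℝ) < 1 / 2 by norm_num),
      eventually_gt_atTop 0] with n hn hn2 hn0
    have hn' : (0 : ℝ) < n := by exact_mod_cast hn0
    have heq : (∑ k ∈ Finset.range n, Real.log (1 + ε n * G n k)) / (n * ε n) -
        (n : ℝ)⁻¹ * ∑ k ∈ Finset.range n, G n k =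
        (∑ k ∈ Finset.range n, (Real.log (1 + ε n * G n k) - ε n * G n k)) / (n * ε n) := by
      rw [Finset.sum_sub_distrib, ← Finset.mul_sum]
      field_simp
    rw [heq, norm_div, Real.norm_eq_abs (_ * _), abs_of_pos (by positivity),
      div_le_iff₀ (by positivity)]
    refine (norm_sum_le_of_le _ (n := fun _ => 2 * (ε n * C) ^ 2) fun k hk => ?_).trans ?_
    · have h1 : |ε n * G n k| ≤ ε n * C := by
        rw [abs_mul, abs_of_pos hn]
        exact mul_le_mul_of_nonneg_left (hG n k (Finset.mem_range.1 hk)) hn.le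
      refine (abs_log_one_add_sub_le (h1.trans hn2.le)).trans ?_
      rw [← sq_abs (ε n * G n k)]
      gcongr
    · rw [Finset.sum_const, Finset.card_range, nsmul_eq_mul]
      exact le_of_eq (by ring)
  simpa using hdiff.add hlim

/-! ### Exponential moments of one summand of the estimator -/

/-- The integral `∫ (exp (r * u * K z) - 1) / r * f (x - b • z) dz`. Multiplied by `r * b ^ d`, it
is the excess over `1` of an exponential moment of `K (b⁻¹ • (x - X))` if `X` has density `f`. -/
noncomputable def kernelMoment {d : ℕ} (K f : EuclideanSpace ℝ (Fin d) → ℝ)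
    (x : EuclideanSpace ℝ (Fin d)) (u r b : ℝ) : ℝ :=
  ∫ z, expQuot r (u * K z) * f (x - b • z)

section KernelMoment

variable {d : ℕ} {K f : EuclideanSpace ℝ (Fin d) → ℝ} {x : EuclideanSpace ℝ (Fin d)}
  {M Mf u : ℝ}

theorem norm_kernelMoment_integrand_le (hM : ∀ z, |K z| ≤ M) (hf : ∀ y, 0 ≤ f y)
    (hMf : ∀ y, f y ≤ Mf) (u : ℝ) {r : ℝ} (hr0 : 0 ≤ r) (hr1 : r ≤ 1) (b : ℝ)
    (z : EuclideanSpace ℝ (Fin d)) :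
    ‖expQuot r (u * K z) * f (x - b • z)‖ ≤ |u| * Real.exp (|u| * M) * |K z| * Mf := by
  rw [norm_mul, Real.norm_eq_abs, Real.norm_eq_abs, abs_of_nonneg (hf _)]
  exact mul_le_mul (abs_expQuot_mul_le hr0 hr1 (hM z)) (hMf _) (hf _) (by positivity)

theorem abs_kernelMoment_le (hK : Integrable K) (hM : ∀ z, |K z| ≤ M) (hf : ∀ y, 0 ≤ f y)
    (hMf : ∀ y, f y ≤ Mf) (u : ℝ) {r : ℝ} (hr0 : 0 ≤ r) (hr1 : r ≤ 1) (b : ℝ) :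
    |kernelMoment K f x u r b| ≤ ∫ z, |u| * Real.exp (|u| * M) * |K z| * Mf :=
  norm_integral_le_of_norm_le ((hK.abs.const_mul _).mul_const _)
    (Filter.Eventually.of_forall (norm_kernelMoment_integrand_le hM hf hMf u hr0 hr1 b))

theorem tendsto_kernelMoment (hK : Integrable K) (hM : ∀ z, |K z| ≤ M) (hf_meas : Measurable f)
    (hf : ∀ y, 0 ≤ f y) (hMf : ∀ y, f y ≤ Mf) (hfx : ContinuousAt f x) (u : ℝ)
    {r b : ℕ → ℝ} {s : ℝ} (hr : ∀ᶠ n in atTop, 0 ≤ r n ∧ r n ≤ 1) (hs : s ≠ 0)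
    (hrs : Tendsto r atTop (𝓝 s)) (hb : Tendsto b atTop (𝓝 0)) :
    Tendsto (fun n => kernelMoment K f x u (r n) (b n)) atTop
      (𝓝 (f x * ∫ z, expQuot s (u * K z))) := by
  rw [mul_comm, ← integral_mul_const]
  refine tendsto_integral_filter_of_dominated_convergence
    (fun z => |u| * Real.exp (|u| * M) * |K z| * Mf) ?_ ?_ ((hK.abs.const_mul _).mul_const _) ?_
  · refine Filter.Eventually.of_forall fun n => ?_
    have h1 := hK.1.aemeasurable
    apply AEMeasurable.aestronglyMeasurable
    unfold expQuot
    fun_prop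
  · filter_upwards [hr] with n hn
    exact Filter.Eventually.of_forall
      (norm_kernelMoment_integrand_le hM hf hMf u hn.1 hn.2 (b n))
  · refine Filter.Eventually.of_forall fun z => ?_
    refine ((continuousAt_expQuot hs _).tendsto.comp hrs).mul ?_
    have h1 : Tendsto (fun n => x - b n • z) atTop (𝓝 x) := by
      simpa using (hb.smul_const z).const_sub x
    exact hfx.tendsto.comp h1

variable {Ω : Type*} [MeasurableSpace Ω] {P : Measure Ω}
  {X : Ω → EuclideanSpace ℝ (Fin d)} {b : ℝ}

theorem aemeasurable_kernel_comp_affine (hK : AEMeasurable K) (hb : b ≠ 0) :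
    AEMeasurable (fun y => K (b⁻¹ • (x - y))) :=
  hK.comp_quasiMeasurePreserving
    ((Measure.quasiMeasurePreserving_smul volume (inv_ne_zero hb)).comp
      (quasiMeasurePreserving_sub_left volume x))

theorem map_absolutelyContinuous
    (hlaw : P.map X = volume.withDensity (fun y => ENNReal.ofReal (f y))) :
    P.map X ≪ volume :=
  hlaw ▸ withDensity_absolutelyContinuous _ _

theorem mgf_kernel_eq [IsProbabilityMeasure P] (hX : Measurable X) (hf_meas : Measurable f)
    (hf : ∀ y, 0 ≤ f y)
    (hlaw : P.map X = volume.withDensity (fun y => ENNReal.ofReal (f y)))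
    (hK : AEMeasurable K) (hM : ∀ z, |K z| ≤ M) (hb : 0 < b) (u : ℝ) {r : ℝ} (hr : r ≠ 0) :
    mgf (fun ω => K (b⁻¹ • (x - X ω))) P (r * u) =
      1 + b ^ d * (r * kernelMoment K f x u r b) := by
  have hmeas : AEMeasurable (fun y => K (b⁻¹ • (x - y))) (P.map X) :=
    (aemeasurable_kernel_comp_affine hK hb.ne').mono_ac (map_absolutelyContinuous hlaw)
  have hW : AEMeasurable (fun ω => K (b⁻¹ • (x - X ω))) P := hmeas.comp_measurable hX
  have hint : Integrable (fun ω => Real.exp (r * u * K (b⁻¹ • (x - X ω)))) P :=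
    integrable_exp_mul_of_mem_Icc hW (Filter.Eventually.of_forall fun ω => abs_le.1 (hM _))
  have h1 : mgf (fun ω => K (b⁻¹ • (x - X ω))) P (r * u) =
      1 + ∫ ω, (Real.exp (r * u * K (b⁻¹ • (x - X ω))) - 1) ∂P := by
    rw [integral_sub hint (integrable_const _), integral_const, mgf]
    simp
  rw [h1]
  congr 1
  have h2 : ∫ ω, (Real.exp (r * u * K (b⁻¹ • (x - X ω))) - 1) ∂P =
      ∫ y, (Real.exp (r * u * K (b⁻¹ • (x - y))) - 1) ∂(P.map X) :=
    (integral_map (f := fun y => Real.exp (r * u * K (b⁻¹ • (x - y))) - 1) hX.aemeasurable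
      ((Real.measurable_exp.comp_aemeasurable (hmeas.const_mul (r * u))).sub_const
        1).aestronglyMeasurable).symm
  rw [h2, hlaw, integral_withDensity_eq_integral_toReal_smul (by fun_prop)
    (Filter.Eventually.of_forall fun _ => ENNReal.ofReal_lt_top)]
  rw [← integral_sub_left_eq_self _ volume x]
  have h3 := Measure.integral_comp_inv_smul_of_nonneg
    (volume : Measure (EuclideanSpace ℝ (Fin d)))
    (fun z => f (x - b • z) * (Real.exp (r * u * K z) - 1)) hb.le
  rw [finrank_euclideanSpace_fin, smul_eq_mul] at h3
  rw [kernelMoment, ← integral_const_mul]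
  calc _ = ∫ y, f (x - b • b⁻¹ • y) * (Real.exp (r * u * K (b⁻¹ • y)) - 1) := by
        refine integral_congr_ae (Filter.Eventually.of_forall fun y => ?_)
        simp only [smul_inv_smul₀ hb.ne', sub_sub_cancel, smul_eq_mul,
          ENNReal.toReal_ofReal (hf _)]
    _ = b ^ d * ∫ z, f (x - b • z) * (Real.exp (r * u * K z) - 1) := h3
    _ = _ := by
        congr 1
        refine integral_congr_ae (Filter.Eventually.of_forall fun z => ?_)
        simp only
        rw [← mul_assoc, mul_expQuot hr, mul_comm, mul_assoc]

end KernelMoment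

/-! ### The estimator with stepsizes `1 / n` -/

/-- With `γ 1 = 1` the initial value `f₀` is forgotten after one step, whence `1 ≤ n`. -/
theorem recursiveEstimator_eq_average {Ω : Type*} {d : ℕ} (K : EuclideanSpace ℝ (Fin d) → ℝ)
    {γ h : ℕ → ℝ} (hγ : ∀ n : ℕ, 1 ≤ n → γ n = (n : ℝ)⁻¹) (X : ℕ → Ω → EuclideanSpace ℝ (Fin d))
    (f₀ : ℝ) (x : EuclideanSpace ℝ (Fin d)) {n : ℕ} (hn : 1 ≤ n) (ω : Ω) :
    recursiveEstimator K γ h X f₀ x n ω =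
      (n : ℝ)⁻¹ * ∑ k ∈ Finset.range n,
        (h (k + 1) ^ d)⁻¹ * K ((h (k + 1))⁻¹ • (x - X k ω)) := by
  induction n, hn using Nat.le_induction with
  | base => simp [recursiveEstimator, hγ 1 le_rfl]
  | succ n hn ih =>
    have hn0 : (n : ℝ) ≠ 0 := by exact_mod_cast (by omega : n ≠ 0)
    have hn1 : (n : ℝ) + 1 ≠ 0 := by positivity
    rw [recursiveEstimator, ih, hγ (n + 1) (by omega), Finset.sum_range_succ]
    push_cast
    field_simp
    ring

section Bandwidth

variable {d : ℕ} {a c : ℝ} {h : ℕ → ℝ}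

theorem bandwidth_pos (hc : 0 < c) (hh : ∀ n : ℕ, 1 ≤ n → h n = c * (n : ℝ) ^ (-a)) {n : ℕ}
    (hn : 1 ≤ n) : 0 < h n := by
  rw [hh n hn]
  have : (0 : ℝ) < n := by exact_mod_cast hn
  positivity

theorem tendsto_bandwidth (ha : 0 < a) (hh : ∀ n : ℕ, 1 ≤ n → h n = c * (n : ℝ) ^ (-a)) :
    Tendsto h atTop (𝓝 0) := by
  have h1 : Tendsto (fun n : ℕ => c * (n : ℝ) ^ (-a)) atTop (𝓝 (c * 0)) :=
    ((tendsto_rpow_neg_atTop ha).comp tendsto_natCast_atTop_atTop).const_mul c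
  rw [mul_zero] at h1
  refine h1.congr' ?_
  filter_upwards [eventually_ge_atTop 1] with n hn using (hh n hn).symm

theorem bandwidth_pow_eq (hh : ∀ n : ℕ, 1 ≤ n → h n = c * (n : ℝ) ^ (-a)) {k n : ℕ}
    (hk : 1 ≤ k) (hn : 1 ≤ n) : h n ^ d = ((k : ℝ) / n) ^ (a * d) * h k ^ d := by
  have hk' : (0 : ℝ) < k := by exact_mod_cast hk
  have hn' : (0 : ℝ) < n := by exact_mod_cast hn
  rw [Real.rpow_mul_natCast (by positivity), ← mul_pow]
  congr 1
  rw [hh n hn, hh k hk, Real.div_rpow hk'.le hn'.le, Real.rpow_neg hk'.le, Real.rpow_neg hn'.le]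
  have := Real.rpow_pos_of_pos hk' a
  field_simp

theorem tendsto_mul_bandwidth_pow (hc : 0 < c) (hd : 0 < d) (had : a < 1 / (d : ℝ))
    (hh : ∀ n : ℕ, 1 ≤ n → h n = c * (n : ℝ) ^ (-a)) :
    Tendsto (fun n : ℕ => (n : ℝ) * h n ^ d) atTop atTop := by
  have hd' : (0 : ℝ) < d := by exact_mod_cast hd
  have h0 : 0 < 1 - a * d := by
    rw [lt_div_iff₀ hd'] at had
    linarith
  have h1 : Tendsto (fun n : ℕ => c ^ d * (n : ℝ) ^ (1 - a * d)) atTop atTop :=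
    ((tendsto_rpow_atTop h0).comp tendsto_natCast_atTop_atTop).const_mul_atTop (by positivity)
  refine h1.congr' ?_
  filter_upwards [eventually_ge_atTop 1] with n hn
  have hn' : (0 : ℝ) < n := by exact_mod_cast hn
  rw [hh n hn, mul_pow, ← Real.rpow_mul_natCast hn'.le, sub_eq_add_neg, Real.rpow_add hn',
    Real.rpow_one, neg_mul]
  ring

end Bandwidth

section Limit

variable {d : ℕ} {K f : EuclideanSpace ℝ (Fin d) → ℝ} {x : EuclideanSpace ℝ (Fin d)}
  {M Mf a c : ℝ} {h : ℕ → ℝ}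

theorem ratio_rpow_mem {k n : ℕ} (ha : 0 < a) (hk : k ≤ n) :
    0 ≤ ((k : ℝ) / n) ^ (a * d) ∧ ((k : ℝ) / n) ^ (a * d) ≤ 1 :=
  ⟨by positivity, Real.rpow_le_one (by positivity)
    (div_le_one_of_le₀ (by exact_mod_cast hk) (by positivity)) (by positivity)⟩

/-- The average is the integral over `s ∈ (0, 1)` of the step function with `k = ⌈s * n⌉`. For
fixed `s` this `k` satisfies `k / n → s` and `h k → 0`, so dominated convergence applies. -/
theorem tendsto_average_kernelMoment (ha : 0 < a) (hh0 : Tendsto h atTop (𝓝 0))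
    (hK : Integrable K) (hM : ∀ z, |K z| ≤ M) (hf_meas : Measurable f) (hf : ∀ y, 0 ≤ f y)
    (hMf : ∀ y, f y ≤ Mf) (hfx : ContinuousAt f x) (u : ℝ) :
    Tendsto (fun n : ℕ => (n : ℝ)⁻¹ * ∑ k ∈ Finset.range n,
      kernelMoment K f x u ((((k + 1 : ℕ) : ℝ) / n) ^ (a * d)) (h (k + 1)))
      atTop (𝓝 (f x * psi a K u)) := by
  rw [psi_eq_intervalIntegral ha hK hM, ← intervalIntegral.integral_const_mul]
  have hEq : ∀ᶠ n : ℕ in atTop, (∫ s in (0 : ℝ)..1, kernelMoment K f x u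
      (((⌈(s * n : ℝ)⌉₊ : ℝ) / n) ^ (a * d)) (h ⌈(s * n : ℝ)⌉₊)) =
      (n : ℝ)⁻¹ * ∑ k ∈ Finset.range n,
      kernelMoment K f x u ((((k + 1 : ℕ) : ℝ) / n) ^ (a * d)) (h (k + 1)) := by
    filter_upwards [eventually_gt_atTop 0] with n hn
    exact (average_eq_integral_ceil
      (fun k => kernelMoment K f x u (((k : ℝ) / n) ^ (a * d)) (h k)) hn).symm
  refine Tendsto.congr' hEq ?_
  have hmem : ∀ s ∈ Set.uIoc (0 : ℝ) 1, ∀ n : ℕ,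
      0 ≤ ((⌈(s * n : ℝ)⌉₊ : ℝ) / n) ^ (a * d) ∧ ((⌈(s * n : ℝ)⌉₊ : ℝ) / n) ^ (a * d) ≤ 1 := by
    intro s hs n
    rw [Set.uIoc_of_le zero_le_one] at hs
    refine ratio_rpow_mem ha (Nat.ceil_le.2 ?_)
    exact mul_le_of_le_one_left (by positivity) hs.2
  refine intervalIntegral.tendsto_integral_filter_of_dominated_convergence
    (fun _ => ∫ z, |u| * Real.exp (|u| * M) * |K z| * Mf) ?_ ?_ intervalIntegrable_const ?_
  · refine Filter.Eventually.of_forall fun n => Measurable.aestronglyMeasurable ?_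
    exact (measurable_from_top (f := fun k : ℕ =>
      kernelMoment K f x u (((k : ℝ) / n) ^ (a * d)) (h k))).comp
      (Nat.measurable_ceil.comp (measurable_id.mul_const _))
  · refine Filter.Eventually.of_forall fun n => Filter.Eventually.of_forall fun s hs => ?_
    exact abs_kernelMoment_le hK hM hf hMf u (hmem s hs n).1 (hmem s hs n).2 _
  · refine Filter.Eventually.of_forall fun s hs => ?_
    have hs' := hs
    rw [Set.uIoc_of_le zero_le_one] at hs'
    refine tendsto_kernelMoment hK hM hf_meas hf hMf hfx u
      (Filter.Eventually.of_forall (hmem s hs)) (Real.rpow_pos_of_pos hs'.1 _).ne' ?_ ?_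
    · exact ((tendsto_nat_ceil_mul_div_atTop hs'.1.le).comp
        tendsto_natCast_atTop_atTop).rpow_const (Or.inl hs'.1.ne')
    · refine hh0.comp (tendsto_nat_ceil_atTop.comp ?_)
      exact tendsto_natCast_atTop_atTop.const_mul_atTop hs'.1

end Limit

/-! ### The large deviations principle for the estimator -/

section Estimator

variable {Ω : Type*} [MeasurableSpace Ω] {P : Measure Ω} {d : ℕ}
  {X : ℕ → Ω → EuclideanSpace ℝ (Fin d)} {K f : EuclideanSpace ℝ (Fin d) → ℝ}
  {x : EuclideanSpace ℝ (Fin d)} {M a c f₀ : ℝ} {h γ : ℕ → ℝ}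

theorem aemeasurable_kernel_observation (hX : ∀ i, Measurable (X i))
    (hlaw : ∀ i, P.map (X i) = volume.withDensity (fun y => ENNReal.ofReal (f y)))
    (hK : AEMeasurable K) (i : ℕ) {b : ℝ} (hb : b ≠ 0) :
    AEMeasurable (fun ω => K (b⁻¹ • (x - X i ω))) P :=
  ((aemeasurable_kernel_comp_affine hK hb).mono_ac
    (map_absolutelyContinuous (hlaw i))).comp_measurable (hX i)

theorem aemeasurable_recursiveEstimator (hX : ∀ i, Measurable (X i))
    (hlaw : ∀ i, P.map (X i) = volume.withDensity (fun y => ENNReal.ofReal (f y)))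
    (hK : AEMeasurable K) (hpos : ∀ n, 1 ≤ n → 0 < h n) (n : ℕ) :
    AEMeasurable (recursiveEstimator K γ h X f₀ x n) P := by
  induction n with
  | zero => exact aemeasurable_const
  | succ n ih =>
    exact (ih.const_mul _).add (((aemeasurable_kernel_observation hX hlaw hK n
      (hpos (n + 1) (by omega)).ne').const_mul _).const_mul _)

theorem exists_abs_recursiveEstimator_le {Ω' : Type*} {X : ℕ → Ω' → EuclideanSpace ℝ (Fin d)}
    (hM : ∀ z, |K z| ≤ M) (n : ℕ) :
    ∃ C, ∀ ω, |recursiveEstimator K γ h X f₀ x n ω| ≤ C := by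
  induction n with
  | zero => exact ⟨|f₀|, fun ω => le_rfl⟩
  | succ n ih =>
    obtain ⟨C, hC⟩ := ih
    refine ⟨|1 - γ (n + 1)| * C + |γ (n + 1)| * (|(h (n + 1) ^ d)⁻¹| * M), fun ω => ?_⟩
    rw [recursiveEstimator]
    refine (abs_add_le _ _).trans ?_
    rw [abs_mul, abs_mul, abs_mul]
    gcongr
    · exact hC ω
    · exact hM _

theorem integrable_exp_recursiveEstimator [IsProbabilityMeasure P] (hX : ∀ i, Measurable (X i))
    (hlaw : ∀ i, P.map (X i) = volume.withDensity (fun y => ENNReal.ofReal (f y)))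
    (hK : AEMeasurable K) (hM : ∀ z, |K z| ≤ M) (hpos : ∀ n, 1 ≤ n → 0 < h n) (y : ℝ) (n : ℕ)
    (u : ℝ) :
    Integrable (fun ω => Real.exp (u * (recursiveEstimator K γ h X f₀ x n ω - y))) P := by
  obtain ⟨C, hC⟩ := exists_abs_recursiveEstimator_le (γ := γ) (h := h) (X := X) (f₀ := f₀)
    (x := x) hM n
  refine integrable_exp_mul_of_mem_Icc (a := -C - y) (b := C - y)
    ((aemeasurable_recursiveEstimator hX hlaw hK hpos n).sub_const y)
    (Filter.Eventually.of_forall fun ω => ?_)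
  have := abs_le.1 (hC ω)
  constructor <;> linarith

/-- The scaled cumulant generating function of the estimator. The scale `n * h n ^ d` turns the
argument for the `k`-th kernel value into `r * u` with `r = (h n / h k) ^ d = (k / n) ^ (a * d)`, and
the factor `r * h k ^ d` in its exponential moment is `h n ^ d` for every `k`. -/
theorem cgf_recursiveEstimator [IsProbabilityMeasure P] (hX : ∀ i, Measurable (X i))
    (hindep : iIndepFun X P)
    (hf_meas : Measurable f) (hf : ∀ y, 0 ≤ f y)
    (hlaw : ∀ i, P.map (X i) = volume.withDensity (fun y => ENNReal.ofReal (f y)))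
    (hK : AEMeasurable K) (hM : ∀ z, |K z| ≤ M) (hc : 0 < c)
    (hh : ∀ n : ℕ, 1 ≤ n → h n = c * (n : ℝ) ^ (-a)) (hγ : ∀ n : ℕ, 1 ≤ n → γ n = (n : ℝ)⁻¹)
    (u y : ℝ) {n : ℕ} (hn : 1 ≤ n) :
    cgf (fun ω => recursiveEstimator K γ h X f₀ x n ω - y) P (n * h n ^ d * u) =
      (∑ k ∈ Finset.range n, Real.log (1 + h n ^ d *
        kernelMoment K f x u ((((k + 1 : ℕ) : ℝ) / n) ^ (a * d)) (h (k + 1)))) -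
      n * h n ^ d * u * y := by
  have hpos : ∀ k : ℕ, 0 < h (k + 1) := fun k => bandwidth_pos hc hh (by omega)
  have hn' : (0 : ℝ) < n := by exact_mod_cast hn
  set W : ℕ → Ω → ℝ := fun k ω => K ((h (k + 1))⁻¹ • (x - X k ω)) with hW
  have hWm : ∀ k, AEMeasurable (W k) P := fun k =>
    aemeasurable_kernel_observation hX hlaw hK k (hpos k).ne'
  set Y : ℕ → Ω → ℝ := fun k ω => ((n : ℝ)⁻¹ * (h (k + 1) ^ d)⁻¹) * W k ω with hY
  have hYm : ∀ k, AEMeasurable (Y k) P := fun k => (hWm k).const_mul _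
  have hYind : iIndepFun Y P := by
    refine hindep.comp₀
      (fun k y => ((n : ℝ)⁻¹ * (h (k + 1) ^ d)⁻¹) * K ((h (k + 1))⁻¹ • (x - y)))
      (fun k => (hX k).aemeasurable) fun k => ?_
    exact ((aemeasurable_kernel_comp_affine hK (hpos k).ne').mono_ac
      (map_absolutelyContinuous (hlaw k))).const_mul _
  have hWint : ∀ k t, Integrable (fun ω => Real.exp (t * W k ω)) P := fun k t =>
    integrable_exp_mul_of_mem_Icc (hWm k) (Filter.Eventually.of_forall fun ω => abs_le.1 (hM _))
  have hYint : ∀ k t, Integrable (fun ω => Real.exp (t * Y k ω)) P := fun k t => by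
    simpa only [hY, mul_assoc] using hWint k (t * ((n : ℝ)⁻¹ * (h (k + 1) ^ d)⁻¹))
  have hsum : (fun ω => recursiveEstimator K γ h X f₀ x n ω - y) =
      fun ω => (∑ k ∈ Finset.range n, Y k) ω + -y := by
    funext ω
    rw [recursiveEstimator_eq_average K hγ X f₀ x hn ω, Finset.sum_apply, Finset.mul_sum,
      sub_eq_add_neg]
    simp only [hY, hW, mul_assoc]
  have hmgf : ∀ k, mgf (Y k) P (n * h n ^ d * u) = 1 + h n ^ d *
      kernelMoment K f x u ((((k + 1 : ℕ) : ℝ) / n) ^ (a * d)) (h (k + 1)) := by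
    intro k
    have hbw := bandwidth_pow_eq (d := d) hh (show 1 ≤ k + 1 by omega) hn
    have hk' : 0 < h (k + 1) ^ d := pow_pos (hpos k) d
    have hr : (((k + 1 : ℕ) : ℝ) / n) ^ (a * d) ≠ 0 :=
      (Real.rpow_pos_of_pos (div_pos (by positivity) hn') _).ne'
    rw [hY, mgf_const_mul]
    have harg : (n : ℝ)⁻¹ * (h (k + 1) ^ d)⁻¹ * (n * h n ^ d * u) =
        (((k + 1 : ℕ) : ℝ) / n) ^ (a * d) * u := by
      rw [hbw]
      field_simp
    rw [harg, hW, mgf_kernel_eq (hX k) hf_meas hf (hlaw k) hK hM (hpos k) u hr, hbw]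
    ring
  rw [hsum, cgf, mgf_add_const, Real.log_mul _ (Real.exp_pos _).ne', Real.log_exp, mul_neg,
    ← sub_eq_add_neg, hYind.mgf_sum₀ hYm, Real.log_prod]
  · simp only [hmgf]
  · exact fun k _ => (mgf_pos (hYint k _)).ne'
  · rw [hYind.mgf_sum₀ hYm]
    exact Finset.prod_ne_zero_iff.2 fun k _ => (mgf_pos (hYint k _)).ne'

end Estimator

theorem theorem1 {Ω : Type*} [MeasurableSpace Ω] (P : Measure Ω) [IsProbabilityMeasure P]
    (d : ℕ) (hd : 0 < d)
    -- i.i.d. observations with bounded density `f`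
    (X : ℕ → Ω → EuclideanSpace ℝ (Fin d)) (hX : ∀ i, Measurable (X i)) (hindep : iIndepFun X P)
    (f : EuclideanSpace ℝ (Fin d) → ℝ) (hf_meas : Measurable f) (hf_nonneg : ∀ y, 0 ≤ f y)
    (hf_bdd : ∃ M : ℝ, ∀ y, f y ≤ M)
    (hlaw : ∀ i, P.map (X i) = volume.withDensity (fun y => ENNReal.ofReal (f y)))
    -- the kernel
    (K : EuclideanSpace ℝ (Fin d) → ℝ) (hK_bdd : ∃ M : ℝ, ∀ z, |K z| ≤ M)
    (hK_int : Integrable K) (hK_one : ∫ z, K z = 1)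
    (hK_lim : Tendsto K (Bornology.cobounded (EuclideanSpace ℝ (Fin d))) (𝓝 0))
    -- bandwidths and stepsizes
    (a c : ℝ) (ha : 0 < a) (had : a < 1 / (d : ℝ)) (hc : 0 < c)
    (h γ : ℕ → ℝ) (hh : ∀ n : ℕ, 1 ≤ n → h n = c * (n : ℝ) ^ (-a))
    (hγ : ∀ n : ℕ, 1 ≤ n → γ n = (n : ℝ)⁻¹)
    (f₀ : ℝ) (x : EuclideanSpace ℝ (Fin d)) (hfx : ContinuousAt f x) :
    (∀ u : ℝ, IntegrableOn (psiIntegrand a K u)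
      ((Set.Icc (0 : ℝ) 1) ×ˢ (Set.univ : Set (EuclideanSpace ℝ (Fin d))))) ∧
    SatisfiesLDP P (fun n ω => recursiveEstimator K γ h X f₀ x n ω - f x)
      (fun n => (n : ℝ) * h n ^ d) (rateFunction a K (f x)) := by
  obtain ⟨M, hM⟩ := hK_bdd
  obtain ⟨Mf, hMf⟩ := hf_bdd
  have hK : AEMeasurable K := hK_int.1.aemeasurable
  have hpos : ∀ n, 1 ≤ n → 0 < h n := fun n hn => bandwidth_pos hc hh hn
  have hh0 : Tendsto h atTop (𝓝 0) := tendsto_bandwidth ha hh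
  refine ⟨fun u => ?_, ?_⟩
  · rw [IntegrableOn, volume_restrict_unit_prod]
    exact integrable_psiIntegrand ha hK_int hM u
  rw [rateFunction_eq_legendre a K (hf_nonneg x)]
  -- The centring condition of the Gärtner–Ellis theorem is `u ≤ ψ_a(u)`, that is `∫ K = 1`.
  refine satisfiesLDP_legendre
    (integrable_exp_recursiveEstimator hX hlaw hK hM hpos (f x))
    (fun n => (aemeasurable_recursiveEstimator hX hlaw hK hpos n).sub_const _)
    (fun n hn => mul_pos (by exact_mod_cast hn) (pow_pos (hpos n hn) d))
    (tendsto_mul_bandwidth_pow hc hd had hh) (fun u => ?_)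
    (((differentiable_psi ha hK_int hM).sub differentiable_id).const_mul (f x))
    (fun u => mul_nonneg (hf_nonneg x) (sub_nonneg.2 (le_psi ha hK_int hM hK_one u)))
  have hε : Tendsto (fun n => h n ^ d) atTop (𝓝 0) := by
    simpa [zero_pow hd.ne'] using hh0.pow d
  have hlog := tendsto_average_log_one_add hε
    ((eventually_ge_atTop 1).mono fun n hn => pow_pos (hpos n hn) d)
    (fun n k hk => abs_kernelMoment_le hK_int hM hf_nonneg hMf u
      (ratio_rpow_mem (d := d) ha (show k + 1 ≤ n from hk)).1
      (ratio_rpow_mem (d := d) ha (show k + 1 ≤ n from hk)).2 (h (k + 1)))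
    (tendsto_average_kernelMoment ha hh0 hK_int hM hf_meas hf_nonneg hMf hfx u)
  rw [mul_sub, mul_comm (f x) u]
  refine (hlog.sub_const (u * f x)).congr' ?_
  filter_upwards [eventually_ge_atTop 1] with n hn
  have hn' : (0 : ℝ) < n := by exact_mod_cast hn
  have := pow_pos (hpos n hn) d
  rw [cgf_recursiveEstimator hX hindep hf_meas hf_nonneg hlaw hK hM hc hh hγ u (f x) hn]
  field_simp
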